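/- **Theorem 3.1.** Let $\mathbb K\in\{\mathbb R,\mathbb C\}$. A Fréchet space over $\mathbb K$ is a Hausdorff locally convex topological vector space over $\mathbb K$ that is metrizable and complete. Let $X$ and $Z_n$ ($n\in\mathbb N$) be Fréchet spaces over $\mathbb K$, and let $T_n:Z_n\to X$ ($n\in\mathbb N$) be continuous linear operators. Put $$Y:=\operatorname{span}\Big(\bigcup_{n\in\mathbb N}T_n(Z_n)\Big).$$ If $Y$ is not closed in $X$, then $X\setminus Y$ is spaceable; that is, there is a closed infinite-dimensional linear subspace $M$ of $X$ with $M\subseteq (X\setminus Y)\cup\{0\}$. -/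

import Mathlib

/-- A Fréchet space over `𝕜`: a Hausdorff locally convex topological vector space (that is, one
whose topology is generated by a family of seminorms) which is metrizable and complete. The
uniform structure is the one of the additive topological group `E`, so that completeness is
completeness as a topological vector space. -/
class IsFrechetSpace (𝕜 E : Type*) [RCLike 𝕜] [AddCommGroup E] [Module 𝕜 E] [UniformSpace E] :
    Prop where
  isUniformAddGroup : IsUniformAddGroup E
  continuousSMul : ContinuousSMul 𝕜 E
  polynormableSpace : PolynormableSpace 𝕜 E
  metrizableSpace : TopologicalSpace.MetrizableSpace E
  completeSpace : CompleteSpace E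

/-- A subset `A` of a topological vector space is spaceable if `A ∪ {0}` contains a closed
infinite-dimensional linear subspace. -/
def IsSpaceable (𝕜 : Type*) {E : Type*} [RCLike 𝕜] [AddCommGroup E] [Module 𝕜 E]
    [TopologicalSpace E] (A : Set E) : Prop :=
  ∃ M : Submodule 𝕜 E, IsClosed (M : Set E) ∧ ¬ FiniteDimensional 𝕜 M ∧ (M : Set E) ⊆ A ∪ {0}

open Filter Topology

/-! ### Summability and the open mapping argument in complete metrizable groups -/

section Groups

variable {G : Type*} [AddCommGroup G]

/-! `Y` is the union of increasing ranges of operators `S n` on finite products of the `Z i`. For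
each `n` one seeks a set `Φ n` of functionals, pointwise bounded on the `n`-th range, yet
arbitrarily large at small vectors of a subspace `D` of `Y`, even after finitely many linear
constraints on vector and functional. If no range is dense in `Y`, Hahn–Banach gives `Φ n` as an
annihilator. If one is dense, it serves as `D`, and the open mapping argument gives `Φ n` as a polar
(`exists_unboundedNearZero_of_range`).

A gliding hump (`exists_closed_submodule_avoiding`) then yields a biorthogonal sequence of small `y
k` and functionals `φ k` with `‖φ k (y k)‖ > k`. The index set is split into infinitely many fibres,
each meeting every `Φ n` infinitely often. `M` consists of those `x` in the closed span of `y` whose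
coefficients `φ k x / φ k (y k)` are constant on each fibre. If such an `x` lies in the `n`-th
range, then `φ k x` stays bounded along the indices for `Φ n` while `φ k (y k)` does not, so every
coefficient is zero. The functionals of `exists_separating_functionals`, built into the
construction, then force `x = 0`. -/

theorem sum_mem_of_add_subset {u : ℕ → Set G} (h0 : ∀ n, (0 : G) ∈ u n)
    (hu : ∀ n, ∀ a ∈ u (n + 1), ∀ b ∈ u (n + 1), a + b ∈ u n) {y : ℕ → G} (hy : ∀ k, y k ∈ u k)
    (n k : ℕ) (t : Finset ℕ) (ht : t ⊆ Finset.Ioc k (k + n)) : ∑ i ∈ t, y i ∈ u k := by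
  classical
  induction n generalizing k t with
  | zero =>
    have : t = ∅ := by simpa using ht
    simp [this, h0]
  | succ n ih =>
    have hrest : ∑ i ∈ t.erase (k + 1), y i ∈ u (k + 1) := by
      refine ih (k + 1) _ fun i hi => ?_
      have h1 := Finset.mem_erase.1 hi
      have h2 := Finset.mem_Ioc.1 (ht h1.2)
      rw [Finset.mem_Ioc]
      omega
    by_cases hk : k + 1 ∈ t
    · rw [← Finset.add_sum_erase t y hk]
      exact hu k _ (hy _) _ hrest
    · rw [Finset.erase_eq_of_notMem hk] at hrest
      simpa using hu k _ hrest _ (h0 _)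

theorem exists_antitone_basis_add_mem [TopologicalSpace G] [IsTopologicalAddGroup G]
    [FirstCountableTopology G] :
    ∃ u : ℕ → Set G, (𝓝 (0 : G)).HasAntitoneBasis u ∧
      ∀ n, ∀ a ∈ u (n + 1), ∀ b ∈ u (n + 1), a + b ∈ u n := by
  obtain ⟨u, hu, h⟩ := IsTopologicalAddGroup.exists_antitone_basis_nhds_zero (G := G)
  exact ⟨u, hu, fun n a ha b hb => h n (Set.add_mem_add ha hb)⟩

variable [UniformSpace G] [IsUniformAddGroup G] [CompleteSpace G]

theorem summable_of_mem_antitone_basis {u : ℕ → Set G} (hb : (𝓝 (0 : G)).HasAntitoneBasis u)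
    (hu : ∀ n, ∀ a ∈ u (n + 1), ∀ b ∈ u (n + 1), a + b ∈ u n) {y : ℕ → G}
    (hy : ∀ k, y k ∈ u k) : Summable y := by
  rw [summable_iff_cauchySeq_finset, cauchySeq_finset_iff_sum_vanishing]
  intro e he
  obtain ⟨k, -, hk⟩ := hb.1.mem_iff.1 he
  refine ⟨Finset.range (k + 1), fun t ht => hk ?_⟩
  refine sum_mem_of_add_subset (fun n => mem_of_mem_nhds (hb.1.mem_of_mem trivial)) hu hy
    (t.sup id) k t fun i hi => ?_
  have h1 : ¬ i < k + 1 := fun h => Finset.disjoint_left.1 ht hi (Finset.mem_range.2 h)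
  have h2 : i ≤ t.sup id := Finset.le_sup (f := id) hi
  rw [Finset.mem_Ioc]
  omega

/-- A continuous homomorphism from a complete metrizable group which is almost open onto a
subgroup `H` of the target covers a neighbourhood of zero in `H`. -/
theorem exists_nhds_subset_range_of_almost_open {E : Type*} [AddCommGroup E] [TopologicalSpace E]
    [IsTopologicalAddGroup E] [FirstCountableTopology E] [T2Space E] [FirstCountableTopology G]
    (S : G →+ E) (hS : Continuous S)
    (H : AddSubgroup E) (hSH : ∀ w, S w ∈ H)
    (h : ∀ U ∈ 𝓝 (0 : G), ∃ N ∈ 𝓝 (0 : E), ∀ x ∈ N, x ∈ H → x ∈ closure (S '' U)) :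
    ∃ N ∈ 𝓝 (0 : E), ∀ x ∈ N, x ∈ H → ∃ w, S w = x := by
  obtain ⟨u, hu, hadd⟩ := exists_antitone_basis_add_mem (G := G)
  obtain ⟨v, hv⟩ := (𝓝 (0 : E)).exists_antitone_basis
  choose N hN hNH using fun k => h (u k) (hu.1.mem_of_mem trivial)
  -- Successive approximation: the remainder stays in `N (k + 1)`, so it can be approximated again,
  -- and in `v k`, so the remainders tend to zero.
  have step : ∀ k (x : {x // x ∈ N k ∧ x ∈ H}), ∃ w, w ∈ u k ∧
      x.1 - S w ∈ N (k + 1) ∩ v k ∧ x.1 - S w ∈ H := by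
    rintro k ⟨x, hxN, hxH⟩
    have hx := hNH k x hxN hxH
    have hnb : {z | x - z ∈ N (k + 1) ∩ v k} ∈ 𝓝 x := by
      have hc : Tendsto (fun z => x - z) (𝓝 x) (𝓝 0) := by
        have : Continuous fun z : E => x - z := by fun_prop
        simpa using this.tendsto x
      exact hc (inter_mem (hN _) (hv.1.mem_of_mem trivial))
    obtain ⟨z, hz, w, hw, rfl⟩ := mem_closure_iff_nhds.1 hx _ hnb
    exact ⟨w, hw, hz, H.sub_mem hxH (hSH w)⟩
  choose g hg1 hg2 hg3 using step
  refine ⟨N 0, hN 0, fun x hx hxH => ?_⟩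
  let r : ∀ k, {x // x ∈ N k ∧ x ∈ H} := fun k =>
    Nat.rec ⟨x, hx, hxH⟩ (fun k x => ⟨x.1 - S (g k x), (hg2 k x).1, hg3 k x⟩) k
  have hr : ∀ k, (r (k + 1)).1 = (r k).1 - S (g k (r k)) := fun k => rfl
  have hsum := summable_of_mem_antitone_basis hu hadd (fun k => hg1 k (r k))
  have hpart : ∀ n, S (∑ k ∈ Finset.range n, g k (r k)) = x - (r n).1 := by
    intro n
    induction n with
    | zero => simp [r]
    | succ n ih => rw [Finset.sum_range_succ, map_add, ih, hr]; abel
  have hr0 : Tendsto (fun n => (r n).1) atTop (𝓝 0) := by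
    -- Only remainders after a correction are controlled: `r (k + 1)` lies in `v k`, while `r 0` is
    -- the given point.
    rw [← tendsto_add_atTop_iff_nat 1]
    refine hv.tendsto fun k => ?_
    rw [hr]
    exact (hg2 k (r k)).2
  have h1 : Tendsto (fun n => S (∑ k ∈ Finset.range n, g k (r k))) atTop (𝓝 (x - 0)) := by
    simp_rw [hpart]
    exact tendsto_const_nhds.sub hr0
  have h2 := (hS.tendsto _).comp hsum.hasSum.tendsto_sum_nat
  exact ⟨_, (tendsto_nhds_unique h2 h1).trans (sub_zero x)⟩

end Groups

/-! ### Recursive choice depending on all earlier values -/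

section Sequences

/-- Since `R k` reads its history only below `k`, the part already built may be padded by an
arbitrary value. -/
theorem exists_seq_of_forall_history {α : Type*} [Nonempty α] (R : ℕ → (ℕ → α) → α → Prop)
    (hR : ∀ k h h' a, (∀ i < k, h i = h' i) → R k h a → R k h' a)
    (H : ∀ k h, ∃ a, R k h a) : ∃ f : ℕ → α, ∀ k, R k f (f k) := by
  classical
  choose c hc using H
  let d : α := Classical.arbitrary α
  let f : ℕ → α := fun k => Nat.strongRec (motive := fun _ => α)
    (fun k ih => c k fun i => if hi : i < k then ih i hi else d) k
  refine ⟨f, fun k => ?_⟩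
  have hf : f k = c k fun i => if i < k then f i else d := by
    simp only [f]
    rw [Nat.strongRec]
    simp
  rw [hf]
  exact hR k _ _ _ (fun i hi => by simp [hi]) (hc k _)

end Sequences

/-! ### Hahn–Banach consequences in locally convex spaces -/

section Polynormable

variable {𝕜 E : Type*} [RCLike 𝕜] [AddCommGroup E] [Module 𝕜 E] [TopologicalSpace E]
  [PolynormableSpace 𝕜 E]

theorem exists_continuous_seminorm_lt_one {U : Set E} (hU : U ∈ 𝓝 0) :
    ∃ p : Seminorm 𝕜 E, Continuous p ∧ ∀ x, p x < 1 → x ∈ U := by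
  have hp := PolynormableSpace.withSeminorms 𝕜 E
  have := hp.continuousSMul
  have := hp.topologicalAddGroup
  obtain ⟨⟨s, r⟩, hr, hs⟩ := hp.hasBasis_zero_ball.mem_iff.1 hU
  set q := s.sup fun p : {p : Seminorm 𝕜 E // Continuous p} => p.1
  have hq : Continuous q := Seminorm.continuous (r := r) (hp.hasBasis_zero_ball.mem_of_mem (i := (s, r)) hr)
  refine ⟨Real.toNNReal r⁻¹ • q, ?_, fun x hx => hs ?_⟩
  · have : ⇑(Real.toNNReal r⁻¹ • q) = fun x => (Real.toNNReal r⁻¹ : ℝ) * q x := by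
      ext x
      rfl
    rw [this]
    fun_prop
  · have h1 : (Real.toNNReal r⁻¹ • q) x = r⁻¹ * q x := by
      rw [smul_apply, NNReal.smul_def, Real.coe_toNNReal _ (inv_nonneg.2 (le_of_lt hr))]
      rfl
    rw [h1, inv_mul_lt_one₀ hr] at hx
    simpa [Seminorm.mem_ball] using hx

theorem exists_norming_functional {p : Seminorm 𝕜 E} (hp : Continuous p) (u : E) :
    ∃ g : E →L[𝕜] 𝕜, (∀ x, ‖g x‖ ≤ p x) ∧ ‖g u‖ = p u := by
  by_cases hu : u = 0
  · exact ⟨0, by simp, by simp [hu]⟩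
  let e := LinearEquiv.toSpanNonzeroSingleton 𝕜 E u hu
  let f : Module.Dual 𝕜 (Submodule.span 𝕜 {u}) := ((p u : ℝ) : 𝕜) • e.symm.toLinearMap
  have he : ∀ x : Submodule.span 𝕜 {u}, ‖f x‖ = p x := by
    intro x
    obtain ⟨a, rfl⟩ := e.surjective x
    have : ((e a : Submodule.span 𝕜 {u}) : E) = a • u := rfl
    simp [f, this, map_smul_eq_mul, norm_smul, mul_comm, abs_of_nonneg (apply_nonneg p u)]
  obtain ⟨g, hg, hgp⟩ := Module.Dual.exists_continuous_extension_of_le_seminorm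
    (Submodule.span 𝕜 {u}) f hp fun x => (he x).le
  refine ⟨g, hgp, ?_⟩
  have := hg ⟨u, Submodule.mem_span_singleton_self u⟩
  rw [this, he]

/-- Separation of a point from a closed absolutely convex set. -/
theorem exists_functional_separating {B : Set E} (hB : B.Nonempty)
    (hBc : ∀ x ∈ B, ∀ y ∈ B, ∀ a b : 𝕜, ‖a‖ + ‖b‖ ≤ 1 → a • x + b • y ∈ B) {d : E}
    (hd : d ∉ closure B) : ∃ g : E →L[𝕜] 𝕜, (∀ x ∈ B, ‖g x‖ ≤ 1) ∧ 1 < ‖g d‖ := by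
  let : Module ℝ E := .restrictScalars ℝ 𝕜 E
  have : IsScalarTower ℝ 𝕜 E := .restrictScalars _ _ _
  have hp := PolynormableSpace.withSeminorms 𝕜 E
  have := hp.continuousSMul
  have := hp.topologicalAddGroup
  have := hp.toLocallyConvexSpace
  have := IsScalarTower.continuousSMul (M := ℝ) (α := E) 𝕜
  have hconv : Convex ℝ B := by
    intro x hx y hy a b ha hb hab
    have := hBc x hx y hy (a : 𝕜) (b : 𝕜) (by
      rw [RCLike.norm_of_nonneg ha, RCLike.norm_of_nonneg hb, hab])
    rwa [← RCLike.real_smul_eq_coe_smul, ← RCLike.real_smul_eq_coe_smul] at this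
  obtain ⟨f, c, hf, hc⟩ := RCLike.geometric_hahn_banach_closed_point (𝕜 := 𝕜) hconv.closure
    isClosed_closure hd
  -- Multiplying `x` by a suitable scalar of norm one turns the bound on real parts into a bound on
  -- norms.
  have hbd : ∀ x ∈ B, ‖f x‖ ≤ c := by
    intro x hx
    obtain ⟨a, ha, hax⟩ := RCLike.exists_norm_eq_mul_self (f x)
    have h1 := hBc x hx x hx a 0 (by simp [ha])
    have h2 := hf _ (subset_closure h1)
    rw [zero_smul, add_zero, map_smul, smul_eq_mul, ← hax, RCLike.ofReal_re] at h2
    exact h2.le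
  have hc0 : 0 < c := by
    obtain ⟨x, hx⟩ := hB
    have h1 := hBc x hx x hx 0 0 (by simp)
    have h2 := hf _ (subset_closure h1)
    simpa using h2
  refine ⟨((c⁻¹ : ℝ) : 𝕜) • f, fun x hx => ?_, ?_⟩
  · rw [smul_apply, norm_smul, RCLike.norm_of_nonneg (by positivity),
      inv_mul_le_one₀ hc0]
    exact hbd x hx
  · rw [smul_apply, norm_smul, RCLike.norm_of_nonneg (by positivity),
      one_lt_inv_mul₀ hc0]
    exact hc.trans_le (RCLike.re_le_norm _)

/-- Countably many functionals attached to each finite set `s` such that, for every sequence `y`,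
those attached to its initial segments separate the points of its closed span. -/
theorem exists_separating_functionals [FirstCountableTopology E] [T2Space E] [DecidableEq E] :
    ∃ A : Finset E → ℕ → E →L[𝕜] 𝕜, ∀ y : ℕ → E,
      ∀ x ∈ closure (Submodule.span 𝕜 (Set.range y) : Set E),
      (∀ j m, A ((Finset.range j).image y) m x = 0) → x = 0 := by
  have hp := PolynormableSpace.withSeminorms 𝕜 E
  have := hp.continuousSMul
  have := hp.topologicalAddGroup
  obtain ⟨v, hv⟩ := (𝓝 (0 : E)).exists_antitone_basis
  choose p hpc hpv using fun r => exists_continuous_seminorm_lt_one (𝕜 := 𝕜)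
    (hv.1.mem_of_mem (i := r) trivial)
  choose g hgp hgu using fun (u : E) (r : ℕ) => exists_norming_functional (hpc r) u
  have hsep : ∀ s : Finset E, ∃ h : ℕ → E,
      (Submodule.span 𝕜 (s : Set E) : Set E) ⊆ closure (Set.range h) := by
    intro s
    obtain ⟨c, hc, hcs⟩ := s.finite_toSet.countable.isSeparable.span (R := 𝕜)
    have hne : c.Nonempty := by
      rw [← closure_nonempty_iff]
      exact ⟨0, hcs (Submodule.zero_mem _)⟩
    obtain ⟨h, rfl⟩ := hc.exists_eq_range hne
    exact ⟨h, hcs⟩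
  choose h hh using hsep
  -- The code `m` picks a point of a sequence whose closure contains the span of `s`, and a seminorm
  -- at which to norm it.
  refine ⟨fun s m => g (h s m.unpair.1) m.unpair.2, fun y x hx hA => ?_⟩
  by_contra hx0
  obtain ⟨r, hr⟩ : ∃ r, x ∉ v r := by
    by_contra! hcon
    obtain ⟨r, -, hr⟩ := hv.1.mem_iff.1 (isOpen_compl_singleton.mem_nhds (Ne.symm hx0))
    exact hr (hcon r) rfl
  have hpx : 1 ≤ p r x := not_lt.1 fun hlt => hr (hpv r x hlt)
  have hnear : ∀ z : E, ∀ ε : ℝ, 0 < ε → {w | p r (z - w) < ε} ∈ 𝓝 z := by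
    intro z ε hε
    have hc : Continuous fun w => p r (z - w) := (hpc r).comp (by fun_prop)
    exact (isOpen_lt hc continuous_const).mem_nhds (by simpa using hε)
  obtain ⟨w, hw1, hw2⟩ := mem_closure_iff_nhds.1 hx _ (hnear x (1 / 4) (by norm_num))
  obtain ⟨j, hj⟩ : ∃ j, w ∈ Submodule.span 𝕜 (((Finset.range j).image y : Finset E) : Set E) := by
    obtain ⟨t, ht, htw⟩ := Submodule.mem_span_finite_of_mem_span hw2
    obtain ⟨s, hs⟩ : ∃ s : Finset ℕ, t = s.image y := by
      obtain ⟨s, -, hs⟩ := (Finset.subset_set_image_iff (s := Set.univ) (f := y)).1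
        (by simpa using ht)
      exact ⟨s, hs.symm⟩
    refine ⟨s.sup id + 1, Submodule.span_mono ?_ htw⟩
    rw [hs, Finset.coe_subset]
    refine Finset.image_subset_image fun i hi => ?_
    rw [Finset.mem_range]
    exact Nat.lt_succ_of_le (Finset.le_sup (f := id) hi)
  obtain ⟨u, hu1, m, rfl⟩ := mem_closure_iff_nhds.1 (hh _ hj) _ (hnear w (1 / 4) (by norm_num))
  -- `u` is within `1/2` of `x`, and its norming functional kills `x`; hence `p r u ≤ p r (x - u) <
  -- 1/2` and `p r x < 1`, a contradiction.
  set u := h ((Finset.range j).image y) m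
  have hg0 : g u r x = 0 := by
    simpa using hA j (Nat.pair m r)
  have h1 : p r (x - u) ≤ p r (x - w) + p r (w - u) := by
    simpa using map_add_le_add (p r) (x - w) (w - u)
  have h2 : p r x ≤ p r (x - u) + p r u := by
    simpa using map_add_le_add (p r) (x - u) u
  have h3 : ‖g u r u‖ ≤ p r (x - u) := by
    have := hgp u r (x - u)
    rwa [map_sub, hg0, zero_sub, norm_neg] at this
  rw [hgu] at h3
  simp only [Set.mem_ofPred_eq] at hw1 hu1
  linarith

end Polynormable

/-! ### The gliding hump construction -/

section Spaceable

variable {𝕜 X : Type*} [RCLike 𝕜] [AddCommGroup X] [Module 𝕜 X]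

/-- Subtracting a finite combination of the `φ i` from `g` kills every `y k`, hence the closed span,
without changing the value at `x`. -/
theorem functional_eq_zero_of_mem_closure_span [TopologicalSpace X] [IsTopologicalAddGroup X]
    [ContinuousSMul 𝕜 X] {y : ℕ → X} {φ : ℕ → X →L[𝕜] 𝕜}
    (hφ : ∀ i k, i ≠ k → φ i (y k) = 0) (hd : ∀ k, φ k (y k) ≠ 0) {g : X →L[𝕜] 𝕜} {I : ℕ}
    (hg : ∀ i, I ≤ i → g (y i) = 0) {x : X}
    (hx : x ∈ closure (Submodule.span 𝕜 (Set.range y) : Set X)) (h0 : ∀ k, φ k x = 0) :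
    g x = 0 := by
  let g' : X →L[𝕜] 𝕜 := g - ∑ i ∈ Finset.range I, (g (y i) / φ i (y i)) • φ i
  have hg' : ∀ z, g' z = g z - ∑ i ∈ Finset.range I, g (y i) / φ i (y i) * φ i z := by
    intro z
    simp [g']
  have hle : Submodule.span 𝕜 (Set.range y) ≤ LinearMap.ker (g' : X →ₗ[𝕜] 𝕜) := by
    rw [Submodule.span_le]
    rintro _ ⟨k, rfl⟩
    change g' (y k) = 0
    rw [hg']
    by_cases hk : k < I
    · rw [Finset.sum_eq_single_of_mem k (Finset.mem_range.2 hk)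
        fun i _ hi => by rw [hφ i k hi, mul_zero], div_mul_cancel₀ _ (hd k), sub_self]
    · rw [hg k (not_lt.1 hk), Finset.sum_eq_zero, sub_zero]
      intro i hi
      rw [hφ i k (by rintro rfl; exact hk (Finset.mem_range.1 hi)), mul_zero]
  have hcl : IsClosed {z | g' z = 0} := isClosed_eq g'.continuous continuous_const
  have : g' x = 0 := closure_minimal (fun z hz => hle hz) hcl hx
  rw [hg'] at this
  simpa [h0] using this

/-- Gluing a biorthogonal sequence along the fibres of `J` gives a closed infinite-dimensional
subspace. -/
theorem exists_closed_submodule_of_biorthogonal [TopologicalSpace X] [IsTopologicalAddGroup X]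
    [ContinuousSMul 𝕜 X] [T2Space X] (y : ℕ → X) (φ : ℕ → X →L[𝕜] 𝕜)
    (hφ : ∀ i k, i ≠ k → φ i (y k) = 0) (hd : ∀ k, φ k (y k) ≠ 0)
    (J : ℕ → ℕ) (hJ : Function.Surjective J)
    (hsum : ∀ j, Summable fun k => if J k = j then y k else 0) :
    ∃ M : Submodule 𝕜 X, IsClosed (M : Set X) ∧ ¬ FiniteDimensional 𝕜 M ∧
      (M : Set X) ⊆ closure (Submodule.span 𝕜 (Set.range y) : Set X) ∧
      ∀ x ∈ M, ∀ k l, J k = J l → φ k x * φ l (y l) = φ l x * φ k (y k) := by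
  let M : Submodule 𝕜 X :=
    { carrier := {x | x ∈ (Submodule.span 𝕜 (Set.range y)).topologicalClosure ∧
        ∀ k l, J k = J l → φ k x * φ l (y l) = φ l x * φ k (y k)}
      add_mem' := fun {a b} ha hb => ⟨Submodule.add_mem _ ha.1 hb.1, fun k l h => by
        simp only [map_add, add_mul, ha.2 k l h, hb.2 k l h]⟩
      zero_mem' := ⟨Submodule.zero_mem _, by simp⟩
      smul_mem' := fun c x hx => ⟨Submodule.smul_mem _ _ hx.1, fun k l h => by
        simp only [map_smul, smul_eq_mul, mul_assoc, hx.2 k l h]⟩ }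
  have hMmem : ∀ x, x ∈ M ↔ x ∈ closure (Submodule.span 𝕜 (Set.range y) : Set X) ∧
      ∀ k l, J k = J l → φ k x * φ l (y l) = φ l x * φ k (y k) := fun x => Iff.rfl
  -- The sum over one fibre has coefficient one there and zero on the others, which gives
  -- independence.
  let e : ℕ → X := fun j => ∑' k, if J k = j then y k else 0
  have hφe : ∀ k j, φ k (e j) = if J k = j then φ k (y k) else 0 := by
    intro k j
    have h1 := (hsum j).hasSum.mapL (φ k)
    have h2 : HasSum (fun i => φ k (if J i = j then y i else 0))
        (if J k = j then φ k (y k) else 0) := by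
      convert hasSum_single (f := fun i => φ k (if J i = j then y i else 0)) k ?_ using 1
      · split_ifs <;> simp
      · intro i hi
        change φ k (if J i = j then y i else 0) = 0
        split_ifs
        · exact hφ k i hi.symm
        · simp
    exact h1.unique h2
  have heM : ∀ j, e j ∈ M := by
    intro j
    rw [hMmem]
    constructor
    · refine mem_closure_of_tendsto (hsum j).hasSum (Eventually.of_forall fun t => ?_)
      refine Submodule.sum_mem _ fun i _ => ?_
      split_ifs
      · exact Submodule.subset_span ⟨i, rfl⟩
      · exact Submodule.zero_mem _
    · intro k l hkl
      rw [hφe, hφe, hkl]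
      split_ifs <;> ring
  refine ⟨M, ?_, fun hfin => ?_, fun x hx => hx.1, fun x hx => hx.2⟩
  · have : (M : Set X) = closure (Submodule.span 𝕜 (Set.range y) : Set X) ∩
        ⋂ k, ⋂ l, ⋂ _ : J k = J l, {x | φ k x * φ l (y l) = φ l x * φ k (y k)} := by
      ext x
      simp [hMmem]
    rw [this]
    refine isClosed_closure.inter (isClosed_iInter fun k => isClosed_iInter fun l =>
      isClosed_iInter fun _ => isClosed_eq ?_ ?_) <;> fun_prop
  · have hli : LinearIndependent 𝕜 fun j => (⟨e j, heM j⟩ : M) := by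
      rw [linearIndependent_iff']
      intro s c hc j hj
      obtain ⟨k, rfl⟩ := hJ j
      have h1 := congrArg (fun z : M => φ k z) hc
      simp only [Submodule.coe_sum, Submodule.coe_smul, map_sum, map_smul, hφe, smul_eq_mul,
        Submodule.coe_zero, map_zero] at h1
      rw [Finset.sum_eq_single_of_mem (J k) hj fun i _ hi => by rw [if_neg (Ne.symm hi), mul_zero],
        if_pos rfl] at h1
      exact (mul_eq_zero.1 h1).resolve_right (hd k)
    have := hli.finite
    exact not_finite ℕ

variable [UniformSpace X] [IsUniformAddGroup X] [ContinuousSMul 𝕜 X] [PolynormableSpace 𝕜 X]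
  [FirstCountableTopology X] [T2Space X] [CompleteSpace X]

theorem exists_closed_submodule_avoiding (D : Submodule 𝕜 X) (Y : ℕ → Set X)
    (Φ : ℕ → Set (X →L[𝕜] 𝕜)) (hΦ : ∀ n, ∀ x ∈ Y n, ∃ C, ∀ φ ∈ Φ n, ‖φ x‖ ≤ C)
    (step : ∀ n (F : Finset X), (∀ x ∈ F, x ∈ D) → ∀ (L : Finset (X →L[𝕜] 𝕜)), ∀ N ∈ 𝓝 (0 : X),
      ∀ R : ℝ, ∃ y ∈ D, y ∈ N ∧ (∀ l ∈ L, l y = 0) ∧ ∃ φ ∈ Φ n, (∀ x ∈ F, φ x = 0) ∧ R < ‖φ y‖) :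
    ∃ M : Submodule 𝕜 X, IsClosed (M : Set X) ∧ ¬ FiniteDimensional 𝕜 M ∧
      ∀ n, ∀ x ∈ M, x ∈ Y n → x = 0 := by
  classical
  obtain ⟨u, hu, hadd⟩ := exists_antitone_basis_add_mem (G := X)
  obtain ⟨A, hA⟩ := exists_separating_functionals (𝕜 := 𝕜) (E := X)
  -- `J` names the fibre and `ν` the set to be avoided; the free third coordinate makes each pair of
  -- values recur infinitely often.
  let J : ℕ → ℕ := fun k => k.unpair.1
  let ν : ℕ → ℕ := fun k => k.unpair.2.unpair.1
  let R : ℕ → (ℕ → D × (X →L[𝕜] 𝕜)) → D × (X →L[𝕜] 𝕜) → Prop := fun k h a =>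
    (a.1 : X) ∈ u k ∧ (∀ i < k, a.2 (h i).1 = 0) ∧ (∀ i < k, (h i).2 a.1 = 0) ∧ a.2 ∈ Φ (ν k) ∧
      (k : ℝ) < ‖a.2 a.1‖ ∧
      ∀ j ≤ k, ∀ m ≤ k, A ((Finset.range j).image fun i => ((h i).1 : X)) m a.1 = 0
  obtain ⟨f, hf⟩ := exists_seq_of_forall_history R (by
    rintro k h h' a hh ⟨h1, h2, h3, h4, h5, h6⟩
    refine ⟨h1, fun i hi => hh i hi ▸ h2 i hi, fun i hi => hh i hi ▸ h3 i hi, h4, h5,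
      fun j hj m hm => ?_⟩
    rw [← h6 j hj m hm]
    congr 2
    refine Finset.image_congr fun i hi => ?_
    rw [hh i ((Finset.mem_range.1 hi).trans_le hj)]) (by
    intro k h
    obtain ⟨y, hyD, hyN, hyL, φ, hφ, hφF, hφy⟩ := step (ν k)
      ((Finset.range k).image fun i => ((h i).1 : X))
      (by
        intro x hx
        obtain ⟨i, -, rfl⟩ := Finset.mem_image.1 hx
        exact (h i).1.2)
      (((Finset.range k).image fun i => (h i).2) ∪
        (Finset.range (k + 1) ×ˢ Finset.range (k + 1)).image fun q =>
          A ((Finset.range q.1).image fun i => ((h i).1 : X)) q.2)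
      (u k) (hu.1.mem_of_mem trivial) k
    refine ⟨(⟨y, hyD⟩, φ), hyN, fun i hi => ?_, fun i hi => ?_, hφ, hφy, fun j hj m hm => ?_⟩
    · exact hφF _ (Finset.mem_image_of_mem _ (Finset.mem_range.2 hi))
    · exact hyL _ (Finset.mem_union_left _ (Finset.mem_image_of_mem _ (Finset.mem_range.2 hi)))
    · exact hyL _ (Finset.mem_union_right _ (Finset.mem_image.2
        ⟨(j, m), by simp; omega, rfl⟩)))
  let y : ℕ → X := fun k => (f k).1
  let φ : ℕ → X →L[𝕜] 𝕜 := fun k => (f k).2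
  have hbi : ∀ i k, i ≠ k → φ i (y k) = 0 := by
    intro i k hik
    rcases lt_or_gt_of_ne hik with h | h
    · exact (hf k).2.2.1 i h
    · exact (hf i).2.1 k h
  have hlarge : ∀ k : ℕ, (k : ℝ) < ‖φ k (y k)‖ := fun k => (hf k).2.2.2.2.1
  have hd : ∀ k, φ k (y k) ≠ 0 := fun k => norm_pos_iff.1 ((Nat.cast_nonneg k).trans_lt (hlarge k))
  have hu0 : ∀ k, (0 : X) ∈ u k := fun k => mem_of_mem_nhds (hu.1.mem_of_mem trivial)
  obtain ⟨M, hMc, hMi, hMs, hMe⟩ := exists_closed_submodule_of_biorthogonal y φ hbi hd J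
    (fun j => ⟨Nat.pair j 0, by simp [J]⟩) (fun j => by
      refine summable_of_mem_antitone_basis hu hadd fun k => ?_
      split_ifs
      · exact (hf k).1
      · exact hu0 k)
  refine ⟨M, hMc, hMi, fun n x hxM hxY => ?_⟩
  have hzero : ∀ k, φ k x = 0 := by
    intro k
    by_contra hk
    obtain ⟨C, hC⟩ := hΦ n x hxY
    obtain ⟨t, ht⟩ := exists_nat_gt (C * ‖φ k (y k)‖ / ‖φ k x‖)
    -- An index in the fibre of `k`, devoted to `Y n` and at least `t`, so that `‖φ l (y l)‖ > t`.
    set l := Nat.pair (J k) (Nat.pair n t) with hl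
    have hJl : J k = J l := by simp [J, hl]
    have hνl : ν l = n := by simp [ν, hl]
    have htl : (t : ℝ) ≤ l := by
      exact_mod_cast (Nat.right_le_pair n t).trans (Nat.right_le_pair _ _)
    have h1 : ‖φ l x‖ ≤ C := hC _ (hνl ▸ (hf l).2.2.2.1)
    have h2 := congrArg norm (hMe x hxM k l hJl)
    rw [norm_mul, norm_mul] at h2
    rw [div_lt_iff₀ (norm_pos_iff.2 hk)] at ht
    have h3 : ‖φ l x‖ * ‖φ k (y k)‖ ≤ C * ‖φ k (y k)‖ := by gcongr
    have h4 : (t : ℝ) * ‖φ k x‖ ≤ ‖φ l (y l)‖ * ‖φ k x‖ := by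
      gcongr
      exact htl.trans (hlarge l).le
    linarith
  refine hA y x (hMs hxM) fun j m => ?_
  refine functional_eq_zero_of_mem_closure_span hbi hd (I := max j m) (fun i hi => ?_) (hMs hxM)
    hzero
  exact (hf i).2.2.2.2.2 j ((le_max_left _ _).trans hi) m ((le_max_right _ _).trans hi)

end Spaceable

/-! ### Unboundedness near zero survives finitely many linear constraints -/

section Unbounded

variable {𝕜 X : Type*} [RCLike 𝕜] [AddCommGroup X] [Module 𝕜 X] [TopologicalSpace X]

theorem exists_ne_zero_smul_mem [ContinuousSMul 𝕜 X] {N : Set X} (hN : N ∈ 𝓝 (0 : X)) (x : X) :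
    ∃ a : 𝕜, a ≠ 0 ∧ a • x ∈ N := by
  have hc : Tendsto (fun a : 𝕜 => a • x) (𝓝 0) (𝓝 0) := by
    have : Continuous fun a : 𝕜 => a • x := by fun_prop
    simpa using this.tendsto 0
  have h1 : ∀ᶠ a : 𝕜 in 𝓝[≠] 0, a • x ∈ N := nhdsWithin_le_nhds (hc hN)
  obtain ⟨a, haN, ha⟩ := (h1.and self_mem_nhdsWithin).exists
  exact ⟨a, ha, haN⟩

/-- The functionals in `Φ` are unbounded on every neighbourhood of zero of the subspace `V`. -/
def UnboundedNearZero (Φ : Set (X →L[𝕜] 𝕜)) (V : Submodule 𝕜 X) : Prop :=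
  ∀ N ∈ 𝓝 (0 : X), ∀ R : ℝ, ∃ d ∈ V, d ∈ N ∧ ∃ φ ∈ Φ, R < ‖φ d‖

theorem unboundedNearZero_of_one_lt [ContinuousSMul 𝕜 X] {Φ : Set (X →L[𝕜] 𝕜)}
    {V : Submodule 𝕜 X} (h : ∀ N ∈ 𝓝 (0 : X), ∃ d ∈ V, d ∈ N ∧ ∃ φ ∈ Φ, 1 < ‖φ d‖) :
    UnboundedNearZero Φ V := by
  intro N hN R
  have hc : Tendsto (fun x : X => (((|R| + 1 : ℝ) : 𝕜)) • x) (𝓝 0) (𝓝 0) := by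
    have : Continuous fun x : X => (((|R| + 1 : ℝ) : 𝕜)) • x := by fun_prop
    simpa using this.tendsto 0
  obtain ⟨d, hdV, hdN, φ, hφ, hd⟩ := h _ (hc hN)
  refine ⟨_, V.smul_mem _ hdV, hdN, φ, hφ, ?_⟩
  rw [map_smul, norm_smul, RCLike.norm_of_nonneg (by positivity)]
  have := le_abs_self R
  nlinarith [abs_nonneg R]

/-- A small `d` is moved into the kernel by a small multiple of a fixed `v` with `l v ≠ 0`;
boundedness of `Φ` at `v` keeps the loss below a constant. -/
theorem UnboundedNearZero.inf_ker [IsTopologicalAddGroup X] [ContinuousSMul 𝕜 X]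
    {Φ : Set (X →L[𝕜] 𝕜)} {V : Submodule 𝕜 X}
    (h : UnboundedNearZero Φ V) (hΦ : ∀ x ∈ V, ∃ C, ∀ φ ∈ Φ, ‖φ x‖ ≤ C) (l : X →L[𝕜] 𝕜) :
    UnboundedNearZero Φ (V ⊓ LinearMap.ker (l : X →ₗ[𝕜] 𝕜)) := by
  by_cases hl : ∀ x ∈ V, l x = 0
  · intro N hN R
    obtain ⟨d, hdV, hd⟩ := h N hN R
    exact ⟨d, ⟨hdV, hl d hdV⟩, hd⟩
  push Not at hl
  obtain ⟨v, hvV, hv⟩ := hl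
  intro N hN R
  obtain ⟨C, hC⟩ := hΦ v hvV
  have h1 : Tendsto (fun x : X => x - (l x / l v) • v) (𝓝 0) (𝓝 0) := by
    have : Continuous fun x : X => x - (l x / l v) • v := by fun_prop
    simpa using this.tendsto 0
  have h2 : Tendsto (fun x : X => ‖l x / l v‖) (𝓝 0) (𝓝 0) := by
    have : Continuous fun x : X => ‖l x / l v‖ := by fun_prop
    simpa using this.tendsto 0
  obtain ⟨d, hdV, ⟨hd1, hd2⟩, φ, hφ, hd⟩ := h _ (inter_mem (h1 hN) (h2 (Iio_mem_nhds one_pos)))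
    (R + |C|)
  refine ⟨d - (l d / l v) • v, ⟨V.sub_mem hdV (V.smul_mem _ hvV), ?_⟩, hd1, φ, hφ, ?_⟩
  · change l (d - (l d / l v) • v) = 0
    simp [hv]
  · rw [map_sub, map_smul, smul_eq_mul]
    have h3 := norm_sub_norm_le (φ d) (l d / l v * φ v)
    have h4 : ‖l d / l v * φ v‖ ≤ 1 * |C| := by
      rw [norm_mul]
      exact mul_le_mul (le_of_lt hd2) ((hC φ hφ).trans (le_abs_self C)) (norm_nonneg _) zero_le_one
    linarith

theorem UnboundedNearZero.inf_ker_finset [IsTopologicalAddGroup X] [ContinuousSMul 𝕜 X]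
    {Φ : Set (X →L[𝕜] 𝕜)} {V : Submodule 𝕜 X}
    (h : UnboundedNearZero Φ V) (hΦ : ∀ x ∈ V, ∃ C, ∀ φ ∈ Φ, ‖φ x‖ ≤ C)
    (L : Finset (X →L[𝕜] 𝕜)) :
    ∃ V' ≤ V, (∀ x ∈ V', ∀ l ∈ L, l x = 0) ∧ UnboundedNearZero Φ V' := by
  classical
  induction L using Finset.induction_on with
  | empty => exact ⟨V, le_rfl, by simp, h⟩
  | insert l L _ ih =>
    obtain ⟨V', hV', hL, hU⟩ := ih
    refine ⟨_, inf_le_left.trans hV', fun x hx k hk => ?_,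
      hU.inf_ker (fun x hx => hΦ x (hV' hx)) l⟩
    rcases Finset.mem_insert.1 hk with rfl | hk
    · exact hx.2
    · exact hL x hx.1 k hk

/-- Closure of a set of functionals under absolutely convex combinations. -/
def AbsConvexFunctionals (Φ : Set (X →L[𝕜] 𝕜)) : Prop :=
  ∀ φ ∈ Φ, ∀ ψ ∈ Φ, ∀ a b : 𝕜, ‖a‖ + ‖b‖ ≤ 1 → a • φ + b • ψ ∈ Φ

/-- Dual to `UnboundedNearZero.inf_ker`: here `φ` is corrected by a bounded multiple of a fixed `g`
with `g x ≠ 0`. -/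
theorem UnboundedNearZero.of_vanishing {Φ : Set (X →L[𝕜] 𝕜)} {V : Submodule 𝕜 X}
    (h : UnboundedNearZero Φ V) (hc : AbsConvexFunctionals Φ) {x : X}
    (hx : ∃ C, ∀ φ ∈ Φ, ‖φ x‖ ≤ C) : UnboundedNearZero {φ ∈ Φ | φ x = 0} V := by
  by_cases h0 : ∀ φ ∈ Φ, φ x = 0
  · intro N hN R
    obtain ⟨d, hdV, hdN, φ, hφ, hd⟩ := h N hN R
    exact ⟨d, hdV, hdN, φ, ⟨hφ, h0 φ hφ⟩, hd⟩
  push Not at h0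
  obtain ⟨g, hg, hgx⟩ := h0
  obtain ⟨C, hC⟩ := hx
  intro N hN R
  have hgpos : 0 < ‖g x‖ := norm_pos_iff.2 hgx
  have hCpos : 0 ≤ C := (norm_nonneg _).trans (hC g hg)
  -- `K` bounds the total size of the coefficients in `φ - (φ x / g x) • g`; dividing by it returns
  -- to `Φ`.
  set K : ℝ := 1 + C / ‖g x‖ with hK
  have hKpos : 0 < K := by positivity
  have h2 : Tendsto (fun z : X => ‖g z‖) (𝓝 0) (𝓝 0) := by
    have : Continuous fun z : X => ‖g z‖ := by fun_prop
    simpa using this.tendsto 0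
  obtain ⟨d, hdV, ⟨hdN, hdg⟩, φ, hφ, hd⟩ := h _ (inter_mem hN (h2 (Iio_mem_nhds one_pos)))
    (K * R + C / ‖g x‖)
  have hφK : ‖φ x / g x‖ ≤ C / ‖g x‖ := by
    rw [norm_div]
    gcongr
    exact hC φ hφ
  refine ⟨d, hdV, hdN, ((K⁻¹ : ℝ) : 𝕜) • φ + (-((K⁻¹ : ℝ) : 𝕜) * (φ x / g x)) • g,
    ⟨hc φ hφ g hg _ _ ?_, ?_⟩, ?_⟩
  · rw [norm_mul, norm_neg, RCLike.norm_of_nonneg (by positivity)]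
    calc K⁻¹ + K⁻¹ * ‖φ x / g x‖ ≤ K⁻¹ + K⁻¹ * (C / ‖g x‖) := by gcongr
      _ = K⁻¹ * K := by rw [hK]; ring
      _ = 1 := inv_mul_cancel₀ hKpos.ne'
  · simp only [add_apply, smul_apply, smul_eq_mul]
    field_simp
    ring
  · have h3 : (((K⁻¹ : ℝ) : 𝕜) • φ + (-((K⁻¹ : ℝ) : 𝕜) * (φ x / g x)) • g) d =
        ((K⁻¹ : ℝ) : 𝕜) * (φ d - φ x / g x * g d) := by
      simp only [add_apply, smul_apply, smul_eq_mul]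
      ring
    rw [h3, norm_mul, RCLike.norm_of_nonneg (by positivity), lt_inv_mul_iff₀ hKpos]
    have h4 := norm_sub_norm_le (φ d) (φ x / g x * g d)
    have h5 : ‖φ x / g x * g d‖ ≤ C / ‖g x‖ * 1 := by
      rw [norm_mul]
      exact mul_le_mul hφK (le_of_lt hdg) (norm_nonneg _) (by positivity)
    linarith

theorem UnboundedNearZero.of_vanishing_finset {Φ : Set (X →L[𝕜] 𝕜)} {V : Submodule 𝕜 X}
    (h : UnboundedNearZero Φ V) (hc : AbsConvexFunctionals Φ) (F : Finset X)
    (hF : ∀ x ∈ F, ∃ C, ∀ φ ∈ Φ, ‖φ x‖ ≤ C) :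
    ∃ Φ' ⊆ Φ, (∀ φ ∈ Φ', ∀ x ∈ F, φ x = 0) ∧ AbsConvexFunctionals Φ' ∧
      UnboundedNearZero Φ' V := by
  classical
  induction F using Finset.induction_on with
  | empty => exact ⟨Φ, subset_rfl, by simp, hc, h⟩
  | insert x F _ ih =>
    obtain ⟨Φ', hΦ', h0, hc', h'⟩ := ih fun z hz => hF z (Finset.mem_insert_of_mem hz)
    obtain ⟨C, hC⟩ := hF x (Finset.mem_insert_self _ _)
    refine ⟨{φ ∈ Φ' | φ x = 0}, fun φ hφ => hΦ' hφ.1, fun φ hφ z hz => ?_, ?_,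
      h'.of_vanishing hc' ⟨C, fun φ hφ => hC φ (hΦ' hφ)⟩⟩
    · rcases Finset.mem_insert.1 hz with rfl | hz
      · exact hφ.2
      · exact h0 φ hφ.1 z hz
    · intro φ hφ ψ hψ a b hab
      exact ⟨hc' φ hφ.1 ψ hψ.1 a b hab, by simp [hφ.2, hψ.2]⟩

/-- A finite-codimensional subspace of an increasing union of subspaces is a complement modulo
one of them. -/
theorem exists_le_sup_of_finset (Y : Submodule 𝕜 X) (V : ℕ → Submodule 𝕜 X) (hV : Monotone V)
    (hYV : ∀ x ∈ Y, ∃ n, x ∈ V n) (L : Finset (X →L[𝕜] 𝕜)) :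
    ∃ K ≤ Y, (∀ x ∈ K, ∀ l ∈ L, l x = 0) ∧ ∃ m, Y ≤ K ⊔ V m := by
  classical
  induction L using Finset.induction_on with
  | empty => exact ⟨Y, le_rfl, by simp, 0, le_sup_left⟩
  | insert l L _ ih =>
    obtain ⟨K, hKY, hL, m, hm⟩ := ih
    refine ⟨K ⊓ LinearMap.ker (l : X →ₗ[𝕜] 𝕜), inf_le_left.trans hKY, fun x hx k hk => ?_, ?_⟩
    · rcases Finset.mem_insert.1 hk with rfl | hk
      · exact hx.2
      · exact hL x hx.1 k hk
    by_cases hl : ∀ x ∈ K, l x = 0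
    · exact ⟨m, hm.trans (sup_le_sup_right (le_inf le_rfl hl) _)⟩
    push Not at hl
    obtain ⟨v, hvK, hv⟩ := hl
    obtain ⟨n, hn⟩ := hYV v (hKY hvK)
    refine ⟨max m n, hm.trans (sup_le (fun x hx => ?_)
      ((hV (le_max_left m n)).trans le_sup_right))⟩
    have h1 : x = (x - (l x / l v) • v) + (l x / l v) • v := by abel
    rw [h1]
    refine Submodule.add_mem_sup ⟨K.sub_mem hx (K.smul_mem _ hvK), ?_⟩
      ((V _).smul_mem _ (hV (le_max_right m n) hn))
    change l (x - (l x / l v) • v) = 0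
    simp [hv]

end Unbounded

/-! ### Functionals detecting a range that is not everything -/

section Ranges

variable {𝕜 X : Type*} [RCLike 𝕜] [AddCommGroup X] [Module 𝕜 X] [UniformSpace X]
  [IsUniformAddGroup X] [ContinuousSMul 𝕜 X] [PolynormableSpace 𝕜 X]

/-- Were `S` almost open into the closure of `D`, it would cover a neighbourhood of zero there and,
by scaling, all of it. So some `closure (S '' U)` misses points of the closure arbitrarily near
zero. `Φ` is the polar of the image of a seminorm ball inside `U`. -/
theorem exists_unboundedNearZero_of_range [FirstCountableTopology X] [T2Space X] {W : Type*} [AddCommGroup W] [Module 𝕜 W]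
    [UniformSpace W] [IsUniformAddGroup W] [PolynormableSpace 𝕜 W]
    [FirstCountableTopology W] [CompleteSpace W] (S : W →L[𝕜] X) (D : Submodule 𝕜 X)
    (hSD : LinearMap.range (S : W →ₗ[𝕜] X) ≤ D.topologicalClosure)
    (hDS : ¬ D.topologicalClosure ≤ LinearMap.range (S : W →ₗ[𝕜] X)) :
    ∃ Φ : Set (X →L[𝕜] 𝕜), (∀ x ∈ LinearMap.range (S : W →ₗ[𝕜] X), ∃ C, ∀ φ ∈ Φ, ‖φ x‖ ≤ C) ∧
      AbsConvexFunctionals Φ ∧ UnboundedNearZero Φ D := by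
  obtain ⟨U, hU, hnot⟩ : ∃ U ∈ 𝓝 (0 : W), ∀ N ∈ 𝓝 (0 : X), ∃ x ∈ N,
      x ∈ D.topologicalClosure ∧ x ∉ closure (S '' U) := by
    by_contra! hcon
    obtain ⟨N, hN, hNS⟩ := exists_nhds_subset_range_of_almost_open
      (S : W →ₗ[𝕜] X).toAddMonoidHom S.continuous D.topologicalClosure.toAddSubgroup
      (fun w => hSD ⟨w, rfl⟩) hcon
    refine hDS fun x hx => ?_
    obtain ⟨a, ha, haN⟩ := exists_ne_zero_smul_mem (𝕜 := 𝕜) hN x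
    obtain ⟨w, hw⟩ := hNS _ haN (D.topologicalClosure.smul_mem a hx)
    refine ⟨a⁻¹ • w, ?_⟩
    rw [map_smul]
    change a⁻¹ • S w = x
    have hw' : S w = a • x := hw
    rw [hw', inv_smul_smul₀ ha]
  obtain ⟨q, -, hq⟩ := exists_continuous_seminorm_lt_one (𝕜 := 𝕜) hU
  refine ⟨{φ | ∀ w, q w < 1 → ‖φ (S w)‖ ≤ 1}, ?_, ?_, ?_⟩
  · rintro _ ⟨w, rfl⟩
    refine ⟨q w + 1, fun φ hφ => ?_⟩
    have hpos : 0 < q w + 1 := by positivity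
    have h1 := hφ ((((q w + 1)⁻¹ : ℝ) : 𝕜) • w) (by
      rw [map_smul_eq_mul, RCLike.norm_of_nonneg (by positivity), inv_mul_lt_one₀ hpos]
      linarith)
    rw [map_smul, map_smul, norm_smul, RCLike.norm_of_nonneg (by positivity),
      inv_mul_le_one₀ hpos] at h1
    exact h1
  · intro φ hφ ψ hψ a b hab w hw
    calc ‖a * φ (S w) + b * ψ (S w)‖ ≤ ‖a‖ * ‖φ (S w)‖ + ‖b‖ * ‖ψ (S w)‖ := by
          rw [← norm_mul, ← norm_mul]
          exact norm_add_le _ _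
      _ ≤ ‖a‖ * 1 + ‖b‖ * 1 := by
          gcongr
          · exact hφ w hw
          · exact hψ w hw
      _ ≤ 1 := by linarith
  · refine unboundedNearZero_of_one_lt fun N hN => ?_
    -- Passing to the interior makes the conditions on `x` open, so `x` can be replaced by a nearby
    -- `d` in `D` itself.
    obtain ⟨x, hxN, hxD, hxc⟩ := hnot _ (interior_mem_nhds.2 hN)
    obtain ⟨d, ⟨hdN, hdc⟩, hdD⟩ := mem_closure_iff.1 hxD _
      (isOpen_interior.inter isClosed_closure.isOpen_compl) ⟨hxN, hxc⟩
    have hdc' : d ∉ closure (S '' {w | q w < 1}) := fun hmem =>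
      hdc (closure_mono (Set.image_mono fun w hw => hq w hw) hmem)
    obtain ⟨g, hg, hgd⟩ := exists_functional_separating (𝕜 := 𝕜)
      (B := S '' {w | q w < 1}) ⟨S 0, 0, by simp, rfl⟩ (by
      rintro _ ⟨w, hw, rfl⟩ _ ⟨z, hz, rfl⟩ a b hab
      refine ⟨a • w + b • z, ?_, by simp⟩
      have h1 : q (a • w + b • z) ≤ ‖a‖ * q w + ‖b‖ * q z := by
        simpa only [map_smul_eq_mul] using map_add_le_add q (a • w) (b • z)
      have hw' : q w < 1 := hw
      have hz' : q z < 1 := hz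
      change q (a • w + b • z) < 1
      have hm : max (q w) (q z) < 1 := max_lt hw' hz'
      have hm0 : 0 ≤ max (q w) (q z) := (apply_nonneg q w).trans (le_max_left _ _)
      calc q (a • w + b • z) ≤ ‖a‖ * q w + ‖b‖ * q z := h1
        _ ≤ ‖a‖ * max (q w) (q z) + ‖b‖ * max (q w) (q z) := by
            gcongr
            · exact le_max_left _ _
            · exact le_max_right _ _
        _ = (‖a‖ + ‖b‖) * max (q w) (q z) := by ring
        _ ≤ 1 * max (q w) (q z) := by gcongr
        _ < 1 := by linarith) hdc'
    exact ⟨d, hdD, interior_subset hdN, g, fun w hw => hg _ ⟨w, hw, rfl⟩, hgd⟩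

theorem exists_small_separated {Y V : Submodule 𝕜 X} (h : ¬ Y ≤ V.topologicalClosure)
    {N : Set X} (hN : N ∈ 𝓝 (0 : X)) (R : ℝ) :
    ∃ y ∈ Y, y ∈ N ∧ ∃ φ : X →L[𝕜] 𝕜, (∀ v ∈ V, φ v = 0) ∧ R < ‖φ y‖ := by
  obtain ⟨y, hyY, hyV⟩ := SetLike.not_le_iff_exists.1 h
  obtain ⟨g, hg, hgy⟩ := exists_functional_separating (𝕜 := 𝕜) (B := (V : Set X)) ⟨0, V.zero_mem⟩
    (fun x hx z hz a b _ => V.add_mem (V.smul_mem a hx) (V.smul_mem b hz)) hyV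
  have hg0 : ∀ v ∈ V, g v = 0 := by
    intro v hv
    by_contra hne
    -- A functional bounded on a subspace vanishes there: this multiple of `v` would have value `2`.
    have := hg _ (V.smul_mem ((2 : 𝕜) / g v) hv)
    rw [map_smul, smul_eq_mul, div_mul_cancel₀ _ hne] at this
    norm_num at this
  obtain ⟨a, ha, haN⟩ := exists_ne_zero_smul_mem (𝕜 := 𝕜) hN y
  have ha' : 0 < ‖a‖ := norm_pos_iff.2 ha
  refine ⟨a • y, Y.smul_mem a hyY, haN, (((|R| + 1) / ‖a‖ : ℝ) : 𝕜) • g, fun v hv => ?_, ?_⟩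
  · simp [hg0 v hv]
  · rw [smul_apply, map_smul, smul_eq_mul, smul_eq_mul, norm_mul, norm_mul,
      RCLike.norm_of_nonneg (by positivity), ← mul_assoc, div_mul_cancel₀ _ ha'.ne']
    have := le_abs_self R
    nlinarith [abs_nonneg R]

end Ranges

/-! ### The dichotomy: a dense range, or none -/

section UnionOfRanges

variable {𝕜 X : Type*} [RCLike 𝕜] [AddCommGroup X] [Module 𝕜 X] [UniformSpace X]
  [IsUniformAddGroup X] [ContinuousSMul 𝕜 X] [PolynormableSpace 𝕜 X]
  [FirstCountableTopology X] [T2Space X] [CompleteSpace X]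

/-- If none of the increasing subspaces `V n` is dense in their union, the step needed for
`exists_closed_submodule_avoiding` follows from the Hahn–Banach theorem alone. -/
theorem exists_closed_submodule_of_not_dense (Y : Submodule 𝕜 X) (V : ℕ → Submodule 𝕜 X)
    (hV : Monotone V) (hYV : ∀ x, x ∈ Y ↔ ∃ n, x ∈ V n)
    (hnd : ∀ n, ¬ Y ≤ (V n).topologicalClosure) :
    ∃ M : Submodule 𝕜 X, IsClosed (M : Set X) ∧ ¬ FiniteDimensional 𝕜 M ∧
      ∀ n, ∀ x ∈ M, x ∈ V n → x = 0 := by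
  refine exists_closed_submodule_avoiding Y (fun n => V n) (fun n => {φ | ∀ x ∈ V n, φ x = 0})
    (fun n x hx => ⟨0, fun φ hφ => by rw [hφ x hx, norm_zero]⟩) fun n F hF L N hN R => ?_
  choose! ι hι using fun x => (hYV x).1
  obtain ⟨K, hKY, hKL, m, hm⟩ := exists_le_sup_of_finset Y V hV (fun x => (hYV x).1) L
  -- `V p` contains `V n`, the complement of `K` modulo which `Y` is covered, and all of `F`.
  let p := max n (max m (F.sup ι))
  have hK : ¬ K ≤ (V p).topologicalClosure := fun h => hnd p (hm.trans (sup_le h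
    ((hV ((le_max_left _ _).trans (le_max_right _ _))).trans (V p).le_topologicalClosure)))
  obtain ⟨y, hyK, hyN, φ, hφ, hR⟩ := exists_small_separated hK hN R
  refine ⟨y, hKY hyK, hyN, hKL y hyK, φ, fun x hx => hφ x (hV (le_max_left _ _) hx),
    fun x hx => hφ x (hV ?_ (hι x (hF x hx))), hR⟩
  exact (Finset.le_sup hx).trans ((le_max_right _ _).trans (le_max_right _ _))

theorem exists_closed_submodule_of_dense {W : ℕ → Type*} [∀ n, AddCommGroup (W n)]
    [∀ n, Module 𝕜 (W n)] [∀ n, UniformSpace (W n)] [∀ n, IsUniformAddGroup (W n)]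
    [∀ n, PolynormableSpace 𝕜 (W n)] [∀ n, FirstCountableTopology (W n)]
    [∀ n, CompleteSpace (W n)] (S : ∀ n, W n →L[𝕜] X) (D : Submodule 𝕜 X)
    (hD : ∀ n, D ≤ LinearMap.range (S n : W n →ₗ[𝕜] X))
    (hSD : ∀ n, LinearMap.range (S n : W n →ₗ[𝕜] X) ≤ D.topologicalClosure)
    (hDS : ∀ n, ¬ D.topologicalClosure ≤ LinearMap.range (S n : W n →ₗ[𝕜] X)) :
    ∃ M : Submodule 𝕜 X, IsClosed (M : Set X) ∧ ¬ FiniteDimensional 𝕜 M ∧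
      ∀ n, ∀ x ∈ M, x ∈ LinearMap.range (S n : W n →ₗ[𝕜] X) → x = 0 := by
  choose Φ hΦ hΦc hΦD using fun n => exists_unboundedNearZero_of_range (S n) D (hSD n) (hDS n)
  refine exists_closed_submodule_avoiding D
    (fun n => LinearMap.range (S n : W n →ₗ[𝕜] X)) Φ hΦ fun n F hF L N hN R => ?_
  obtain ⟨Φ', hΦ', hF0, -, hU⟩ := (hΦD n).of_vanishing_finset (hΦc n) F
    fun x hx => hΦ n x (hD n (hF x hx))
  obtain ⟨D', hD', hL, hU'⟩ := hU.inf_ker_finset (fun x hx =>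
    (hΦ n x (hD n hx)).imp fun C hC φ hφ => hC φ (hΦ' hφ)) L
  obtain ⟨y, hyD, hyN, φ, hφ, hR⟩ := hU' N hN R
  exact ⟨y, hD' hyD, hyN, hL y hyD, φ, hΦ' hφ, hF0 φ hφ, hR⟩

theorem exists_closed_submodule_avoiding_ranges {W : ℕ → Type*} [∀ n, AddCommGroup (W n)]
    [∀ n, Module 𝕜 (W n)] [∀ n, UniformSpace (W n)] [∀ n, IsUniformAddGroup (W n)]
    [∀ n, PolynormableSpace 𝕜 (W n)] [∀ n, FirstCountableTopology (W n)]
    [∀ n, CompleteSpace (W n)] (S : ∀ n, W n →L[𝕜] X) (Y : Submodule 𝕜 X)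
    (hS : Monotone fun n => LinearMap.range (S n : W n →ₗ[𝕜] X))
    (hYS : ∀ x, x ∈ Y ↔ ∃ n, x ∈ LinearMap.range (S n : W n →ₗ[𝕜] X))
    (hY : ¬ IsClosed (Y : Set X)) :
    ∃ M : Submodule 𝕜 X, IsClosed (M : Set X) ∧ ¬ FiniteDimensional 𝕜 M ∧
      ∀ x ∈ M, x ∈ Y → x = 0 := by
  by_cases h : ∃ m, Y ≤ (LinearMap.range (S m : W m →ₗ[𝕜] X)).topologicalClosure
  · obtain ⟨m, hm⟩ := h
    have hle : ∀ n, LinearMap.range (S n : W n →ₗ[𝕜] X) ≤ Y := fun n x hx => (hYS x).2 ⟨n, hx⟩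
    -- Otherwise `Y` would equal this closure and be closed. Dropping the ranges before `m` costs
    -- nothing, as they increase.
    have hnle : ∀ n, ¬ (LinearMap.range (S m : W m →ₗ[𝕜] X)).topologicalClosure ≤
        LinearMap.range (S (m + n) : W (m + n) →ₗ[𝕜] X) := fun n hn => hY (by
      rw [hm.antisymm (hn.trans (hle _))]
      exact Submodule.isClosed_topologicalClosure _)
    obtain ⟨M, hMc, hMi, hM⟩ := exists_closed_submodule_of_dense (fun n => S (m + n))
      (LinearMap.range (S m : W m →ₗ[𝕜] X)) (fun n => hS (Nat.le_add_right m n))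
      (fun n => (hle _).trans hm) hnle
    refine ⟨M, hMc, hMi, fun x hx hxY => ?_⟩
    obtain ⟨n, hn⟩ := (hYS x).1 hxY
    exact hM n x hx (hS (Nat.le_add_left n m) hn)
  · push Not at h
    obtain ⟨M, hMc, hMi, hM⟩ := exists_closed_submodule_of_not_dense Y _ hS hYS h
    exact ⟨M, hMc, hMi, fun x hx hxY => ((hYS x).1 hxY).elim fun n hn => hM n x hx hn⟩

end UnionOfRanges

/-! ### Reduction to increasing ranges -/

theorem range_sum_comp_proj {R E : Type*} [Semiring R] [AddCommMonoid E] [Module R E]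
    {ι : Type*} [Fintype ι] [DecidableEq ι] {Z : ι → Type*} [∀ i, AddCommMonoid (Z i)]
    [∀ i, Module R (Z i)] (T : ∀ i, Z i →ₗ[R] E) :
    LinearMap.range (∑ i, T i ∘ₗ LinearMap.proj i : (∀ i, Z i) →ₗ[R] E) =
      ⨆ i, LinearMap.range (T i) := by
  apply le_antisymm
  · rintro _ ⟨w, rfl⟩
    rw [LinearMap.sum_apply]
    exact Submodule.sum_mem _ fun i _ => Submodule.mem_iSup_of_mem i ⟨w i, rfl⟩
  · refine iSup_le fun i => ?_
    rintro _ ⟨z, rfl⟩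
    refine ⟨Pi.single i z, ?_⟩
    rw [LinearMap.sum_apply, Finset.sum_eq_single_of_mem i (Finset.mem_univ i)]
    · simp
    · intro j _ hj
      simp [hj]

theorem theorem3p1 {𝕜 : Type*} [RCLike 𝕜]
    {X : Type*} [AddCommGroup X] [Module 𝕜 X] [UniformSpace X] [IsFrechetSpace 𝕜 X]
    {Z : ℕ → Type*} [∀ n, AddCommGroup (Z n)] [∀ n, Module 𝕜 (Z n)] [∀ n, UniformSpace (Z n)]
    [∀ n, IsFrechetSpace 𝕜 (Z n)]
    (T : ∀ n, Z n →L[𝕜] X)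
    (hY : ¬ IsClosed (Submodule.span 𝕜 (⋃ n, Set.range (T n)) : Set X)) :
    IsSpaceable 𝕜 ((Submodule.span 𝕜 (⋃ n, Set.range (T n)) : Set X)ᶜ) := by
  have := IsFrechetSpace.isUniformAddGroup 𝕜 (E := X)
  have := IsFrechetSpace.continuousSMul (𝕜 := 𝕜) (E := X)
  have := IsFrechetSpace.polynormableSpace (𝕜 := 𝕜) (E := X)
  have := IsFrechetSpace.metrizableSpace 𝕜 (E := X)
  have := IsFrechetSpace.completeSpace 𝕜 (E := X)
  have := fun n => IsFrechetSpace.isUniformAddGroup 𝕜 (E := Z n)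
  have := fun n => IsFrechetSpace.polynormableSpace (𝕜 := 𝕜) (E := Z n)
  have := fun n => IsFrechetSpace.metrizableSpace 𝕜 (E := Z n)
  have := fun n => IsFrechetSpace.completeSpace 𝕜 (E := Z n)
  -- Summing the first `n + 1` operators on the product makes the ranges increase, with union the
  -- span.
  let S : ∀ n, (∀ i : Fin (n + 1), Z i) →L[𝕜] X := fun n =>
    ∑ i : Fin (n + 1), T i ∘L ContinuousLinearMap.proj i
  have hS : ∀ n, LinearMap.range (S n : (∀ i : Fin (n + 1), Z i) →ₗ[𝕜] X) =
      ⨆ i : Fin (n + 1), LinearMap.range (T i : Z i →ₗ[𝕜] X) := by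
    intro n
    rw [← range_sum_comp_proj]
    congr 1
    ext w
    simp [S]
  have hmono : Monotone fun n =>
      LinearMap.range (S n : (∀ i : Fin (n + 1), Z i) →ₗ[𝕜] X) := by
    intro m n hmn
    simp only [hS]
    exact iSup_le fun i => le_iSup (fun i : Fin (n + 1) => LinearMap.range (T i : Z i →ₗ[𝕜] X))
      ⟨i, by omega⟩
  obtain ⟨M, hMc, hMi, hM⟩ := exists_closed_submodule_avoiding_ranges S
    (Submodule.span 𝕜 (⋃ n, Set.range (T n))) hmono (by
      intro x
      rw [← Submodule.mem_iSup_of_directed _ hmono.directed_le]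
      refine SetLike.ext_iff.1 (le_antisymm ?_ ?_) x
      · rw [Submodule.span_le, Set.iUnion_subset_iff]
        rintro n _ ⟨z, rfl⟩
        refine Submodule.mem_iSup_of_mem n ?_
        rw [hS]
        exact Submodule.mem_iSup_of_mem (Fin.last n) ⟨z, rfl⟩
      · refine iSup_le fun n => ?_
        rw [hS]
        refine iSup_le fun i => ?_
        rintro _ ⟨z, rfl⟩
        exact Submodule.subset_span (Set.mem_iUnion.2 ⟨i, z, rfl⟩)) hY
  refine ⟨M, hMc, hMi, fun x hx => ?_⟩
  by_cases hxY : x ∈ Submodule.span 𝕜 (⋃ n, Set.range (T n))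
  · exact Or.inr (hM x hx hxY)
  · exact Or.inl hxY
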